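/- Let $\Omega$ be a Cantor group, that is, a totally disconnected compact abelian topological group with no isolated points, and let $T:\Omega\to\Omega$, $T\omega=\omega+\alpha$, be a minimal translation, that is, for every $\omega\in\Omega$ the orbit $\{T^n\omega : n\in\mathbb{Z}\}$ is dense in $\Omega$. For $f\in C(\Omega,\mathbb{R})$ and $\omega\in\Omega$ let $H_\omega$ be the bounded operator on the complex Hilbert space $\ell^2(\mathbb{Z})$ given by $$[H_\omega\psi](n)=\psi(n+1)+\psi(n-1)+f(T^n\omega)\,\psi(n),\qquad n\in\mathbb{Z}.$$ Then there exists a dense $G_\delta$ set $\mathcal{C}\subseteq C(\Omega,\mathbb{R})$ (with respect to the uniform norm) such that for every $f\in\mathcal{C}$ and every $\omega\in\Omega$ the spectrum of $H_\omega$ is a Cantor set, that is, a nonempty closed subset of $\mathbb{R}$ with empty interior and no isolated points. -/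

import Mathlib

open scoped lp ENNReal Topology

namespace LimitPeriodic

/-- A Cantor group: a totally disconnected compact abelian topological group with no isolated
points. -/
class IsCantorGroup (Ω : Type*) [AddCommGroup Ω] [TopologicalSpace Ω] : Prop extends
  IsTopologicalAddGroup Ω, CompactSpace Ω, TotallyDisconnectedSpace Ω, PerfectSpace Ω

/-- `T` is a translation, `T ω = ω + α` for some fixed `α`. -/
def IsTranslation {Ω : Type*} [AddCommGroup Ω] [TopologicalSpace Ω] (T : Ω ≃ₜ Ω) : Prop :=
  ∃ α : Ω, ∀ ω : Ω, T ω = ω + α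

/-- `T` is minimal: every two-sided orbit `{T ^ n ω : n ∈ ℤ}` is dense. -/
def IsMinimalHomeo {Ω : Type*} [TopologicalSpace Ω] (T : Ω ≃ₜ Ω) : Prop :=
  ∀ ω : Ω, Dense (Set.range fun n : ℤ => (T ^ n) ω)

/-- A Cantor set in `ℝ`: a nonempty closed set with empty interior and no isolated points. -/
structure IsCantorSet (K : Set ℝ) : Prop where
  nonempty : K.Nonempty
  isClosed : IsClosed K
  interior_eq_empty : interior K = ∅
  no_isolated : ∀ x ∈ K, AccPt x (Filter.principal K)

/-- The potential `V_ω n = f (T ^ n ω)`, a bounded real sequence. -/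
def potential {Ω : Type*} [TopologicalSpace Ω] [CompactSpace Ω] (T : Ω ≃ₜ Ω) (f : C(Ω, ℝ))
    (ω : Ω) : ℓ^∞(ℤ, ℝ) :=
  ⟨fun n : ℤ => f ((T ^ n) ω), memℓp_infty
    ⟨‖f‖, by rintro _ ⟨n, rfl⟩; exact f.norm_coe_le_norm _⟩⟩

/-- The translation `(S_k ψ) n = ψ (n + k)` on `ℓ²(ℤ)`. -/
noncomputable def shift (k : ℤ) : ℓ²(ℤ, ℂ) →L[ℂ] ℓ²(ℤ, ℂ) :=
  LinearMap.mkContinuous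
    { toFun := fun ψ => ⟨fun n : ℤ => ψ (n + k), (memℓp_gen_iff (by norm_num)).2
        ((Equiv.addRight k).summable_iff.2 ((lp.memℓp ψ).summable (by norm_num)))⟩
      map_add' := fun _ _ => by ext; rfl
      map_smul' := fun _ _ => by ext; rfl }
    1
    (fun ψ => by
      rw [one_mul]
      refine lp.norm_le_of_tsum_le (by norm_num) (norm_nonneg _) ?_
      rw [lp.norm_rpow_eq_tsum (by norm_num)]
      exact ((Equiv.addRight k).tsum_eq fun n : ℤ => ‖ψ n‖ ^ (2 : ℝ≥0∞).toReal).le)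

/-- Multiplication by the bounded real sequence `V` on `ℓ²(ℤ)`. -/
noncomputable def mulPotential (V : ℓ^∞(ℤ, ℝ)) : ℓ²(ℤ, ℂ) →L[ℂ] ℓ²(ℤ, ℂ) :=
  lp.mapCLM 2 (fun n : ℤ => ((V n : ℝ) : ℂ) • ContinuousLinearMap.id ℂ ℂ) (norm_nonneg V)
    (fun n => by
      rw [norm_smul, Complex.norm_real, ContinuousLinearMap.norm_id, mul_one]
      exact lp.norm_apply_le_norm (by simp) V n)

/-- The discrete Schrödinger operator `(H ψ) n = ψ (n + 1) + ψ (n - 1) + V n * ψ n` on the complex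
Hilbert space `ℓ²(ℤ)`. -/
noncomputable def schrodinger (V : ℓ^∞(ℤ, ℝ)) : ℓ²(ℤ, ℂ) →L[ℂ] ℓ²(ℤ, ℂ) :=
  shift 1 + shift (-1) + mulPotential V

theorem schrodinger_apply (V : ℓ^∞(ℤ, ℝ)) (ψ : ℓ²(ℤ, ℂ)) (n : ℤ) :
    schrodinger V ψ n = ψ (n + 1) + ψ (n - 1) + (V n : ℂ) * ψ n :=
  rfl

end LimitPeriodic

/-! For a fixed interval, the set of `f` whose spectrum at phase 0 misses some point of it is open,
since invertibility is an open condition and `H` depends continuously on `f`. If it is also dense,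
Baire's theorem over the rational intervals gives a dense Gδ set on which the spectrum has empty
interior. Minimality makes the spectrum independent of the phase (`spectrum_eq`).

Density: functions factoring through finite quotients of Ω are dense and give periodic potentials
along the orbit. For period `p` the discriminant Δ, the trace of the monodromy, satisfies Δ(H) = S^p
+ S^(-p), so |Δ(E)| > 2 excludes `E` from the spectrum (`notMem_spectrum_of_hyperbolic`). If |Δ| ≤ 2
on the whole interval, write Δ = 2 cos θ on a subinterval. For large `k` the angle kθ sweeps at
least a full turn there, and changing the potential by δ at one site per `k * p` adds δ times an
off-diagonal entry to the trace 2 cos kθ. Where kθ is slightly positive modulo 2π, the gain of this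
term beats the quadratic loss of the cosine, and the trace passes 2 (`exists_hyperbolic`). Finer
quotients of Ω supply such periods, because α has infinite order (`exists_openAddSubgroup_order`).

Isolated points are impossible for every `f`: at one there would be a spectral projection onto
eigenvectors. Recurrence of the translation produces shifts of an eigenvector that almost lie in its
range, yet are small at the sites 0 and 1, whose values control the norm of an eigenvector
(`accPt_spectrum`). -/

namespace LimitPeriodic

/-! ### Transfer matrices and the discriminant -/

section Transfer

variable {R : Type*} [CommRing R]

/-- The one-step transfer matrix of `u (n + 1) + u (n - 1) + v u n = x u n`. -/
def stepMatrix (x v : R) : Matrix (Fin 2) (Fin 2) R := !![x - v, -1; 1, 0]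

/-- The `k`-step transfer matrix starting from site `n`. -/
def transfer (x : R) (v : ℤ → R) (n : ℤ) : ℕ → Matrix (Fin 2) (Fin 2) R
  | 0 => 1
  | k + 1 => stepMatrix x (v (n + k)) * transfer x v n k

theorem det_stepMatrix (x v : R) : (stepMatrix x v).det = 1 := by
  simp [stepMatrix, Matrix.det_fin_two]

theorem det_transfer (x : R) (v : ℤ → R) (n : ℤ) (k : ℕ) : (transfer x v n k).det = 1 := by
  induction k with
  | zero => simp [transfer]
  | succ k ih => rw [transfer, Matrix.det_mul, ih, det_stepMatrix, one_mul]

theorem transfer_add (x : R) (v : ℤ → R) (n : ℤ) (j k : ℕ) :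
    transfer x v n (j + k) = transfer x v (n + j) k * transfer x v n j := by
  induction k with
  | zero => simp [transfer]
  | succ k ih =>
    rw [← add_assoc, transfer, ih, transfer, Matrix.mul_assoc]
    push_cast
    rw [add_assoc]

theorem transfer_periodic {v : ℤ → R} {p : ℤ} (hv : Function.Periodic v p) (x : R) (n : ℤ)
    (k : ℕ) : transfer x v (n + p) k = transfer x v n k := by
  induction k with
  | zero => rfl
  | succ k ih => rw [transfer, transfer, ih, add_right_comm, hv]

theorem transfer_mul {v : ℤ → R} {p : ℕ} (hv : Function.Periodic v p) (x : R) (n : ℤ) (k : ℕ) :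
    transfer x v n (k * p) = transfer x v n p ^ k := by
  induction k with
  | zero => simp [transfer]
  | succ k ih =>
    have h : Function.Periodic v ((k * p : ℕ) : ℤ) := by
      simpa using hv.nat_mul k
    rw [add_mul, one_mul, transfer_add, transfer_periodic h, ih, pow_succ']

/-- Monodromies based at consecutive sites are conjugate by a one-step matrix. -/
theorem trace_transfer_succ {v : ℤ → R} {p : ℕ} (hv : Function.Periodic v p) (x : R) (n : ℤ) :
    (transfer x v (n + 1) p).trace = (transfer x v n p).trace := by
  have h1 : transfer x v (n + 1) p * stepMatrix x (v n) =
      stepMatrix x (v n) * transfer x v n p := by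
    have h2 := transfer_add x v n 1 p
    rw [add_comm 1 p, transfer, hv] at h2
    simpa [transfer] using h2.symm
  have hu : IsUnit (stepMatrix x (v n)).det := by rw [det_stepMatrix]; exact isUnit_one
  calc (transfer x v (n + 1) p).trace
      = (transfer x v (n + 1) p * stepMatrix x (v n) * (stepMatrix x (v n))⁻¹).trace := by
        rw [Matrix.mul_nonsing_inv_cancel_right _ _ hu]
    _ = _ := by rw [h1, Matrix.trace_mul_comm, Matrix.nonsing_inv_mul_cancel_left _ _ hu]

theorem trace_transfer {v : ℤ → R} {p : ℕ} (hv : Function.Periodic v p) (x : R) (n : ℤ) :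
    (transfer x v n p).trace = (transfer x v 0 p).trace := by
  induction n using Int.induction_on with
  | zero => rfl
  | succ n ih => rw [trace_transfer_succ hv, ih]
  | pred n ih => rw [← ih, ← trace_transfer_succ hv, sub_add_cancel]

theorem transfer_map {S : Type*} [CommRing S] (φ : R →+* S) (x : R) (v : ℤ → R) (n : ℤ) (k : ℕ) :
    (transfer x v n k).map φ = transfer (φ x) (fun m => φ (v m)) n k := by
  induction k with
  | zero => simp [transfer]
  | succ k ih =>
    rw [transfer, transfer, Matrix.map_mul, ih]
    congr 1
    ext i j
    fin_cases i <;> fin_cases j <;> simp [stepMatrix]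

/-- Solutions take values in an arbitrary module so that the site vectors of ℓ²(ℤ), over a
polynomial ring acting through `H`, are covered. -/
theorem transfer_solution {M : Type*} [AddCommGroup M] [Module R M] {x : R} {v : ℤ → R}
    {u : ℤ → M} (hu : ∀ n, x • u n = u (n + 1) + u (n - 1) + v n • u n) (n : ℤ) (k : ℕ) :
    u (n + k) = transfer x v n k 0 0 • u n + transfer x v n k 0 1 • u (n - 1) ∧
      u (n + k - 1) = transfer x v n k 1 0 • u n + transfer x v n k 1 1 • u (n - 1) := by
  induction k with
  | zero => simp [transfer]
  | succ k ih =>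
    obtain ⟨h1, h2⟩ := ih
    have h3 : u (n + (k + 1 : ℕ)) = (x - v (n + k)) • u (n + k) - u (n + k - 1) := by
      have := hu (n + k)
      rw [sub_smul, this]
      push_cast
      rw [add_assoc]
      abel_nf
    have h4 : n + ((k + 1 : ℕ) : ℤ) - 1 = n + k := by push_cast; ring
    refine ⟨?_, ?_⟩
    · rw [h3, h1, h2]
      simp only [transfer, stepMatrix, Matrix.mul_apply, Fin.sum_univ_two, Matrix.cons_val',
        Matrix.cons_val_zero, Matrix.cons_val_one, Matrix.of_apply, Matrix.cons_val_fin_one]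
      module
    · rw [h4, h1]
      simp [transfer, stepMatrix, Matrix.mul_apply, Fin.sum_univ_two]

/-- Discriminant identity: a solution of a `p`-periodic equation satisfies the constant
coefficient equation `u (n + p) + u (n - p) = Δ u n`. -/
theorem discriminant_smul {M : Type*} [AddCommGroup M] [Module R M] {x : R} {v : ℤ → R}
    {u : ℤ → M} (hu : ∀ n, x • u n = u (n + 1) + u (n - 1) + v n • u n)
    {p : ℕ} (hv : Function.Periodic v p) (n : ℤ) :
    (transfer x v 0 p).trace • u n = u (n + p) + u (n - p) := by
  obtain ⟨h1, -⟩ := transfer_solution hu n p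
  obtain ⟨h3, h4⟩ := transfer_solution hu (n - p) p
  have hM : transfer x v (n - p) p = transfer x v n p := by
    rw [← transfer_periodic hv, sub_add_cancel]
  rw [hM, sub_add_cancel] at h3 h4
  have hd := det_transfer x v n p
  rw [Matrix.det_fin_two] at hd
  have h5 : u (n - p) = transfer x v n p 1 1 • u n - transfer x v n p 0 1 • u (n - 1) := by
    rw [h3, h4]
    have : u (n - p) = (transfer x v n p 0 0 * transfer x v n p 1 1 -
      transfer x v n p 0 1 * transfer x v n p 1 0) • u (n - p) := by rw [hd, one_smul]
    conv_lhs => rw [this]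
    module
  rw [← trace_transfer hv x n, Matrix.trace_fin_two, h1, h5]
  module

/-- Changing the potential at the initial site only multiplies the transfer matrix by a
unipotent. -/
theorem transfer_perturb {v w : ℤ → R} {ε : R} {n : ℤ} {k : ℕ} (h0 : w n = v n + ε)
    (h : ∀ j : ℕ, 0 < j → j < k → w (n + j) = v (n + j)) (hk : 0 < k) (x : R) :
    transfer x w n k = transfer x v n k * !![1, 0; ε, 1] := by
  induction k with
  | zero => exact absurd hk (lt_irrefl 0)
  | succ k ih =>
    rcases Nat.eq_zero_or_pos k with rfl | hk'
    · ext i j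
      fin_cases i <;> fin_cases j <;>
        simp [transfer, stepMatrix, h0, Matrix.mul_apply, Fin.sum_univ_two]
      ring
    · rw [transfer, transfer, ih (fun j hj hjk => h j hj (hjk.trans k.lt_succ_self)) hk',
        h k hk' k.lt_succ_self, Matrix.mul_assoc]

theorem trace_transfer_perturb {v w : ℤ → R} {ε : R} {n : ℤ} {k : ℕ} (h0 : w n = v n + ε)
    (h : ∀ j : ℕ, 0 < j → j < k → w (n + j) = v (n + j)) (hk : 0 < k) (x : R) :
    (transfer x w n k).trace = (transfer x v n k).trace + ε * transfer x v n k 0 1 := by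
  rw [transfer_perturb h0 h hk]
  simp [Matrix.trace_fin_two, Matrix.mul_apply, Fin.sum_univ_two]
  ring

-- The entries are bounded together because the recursion couples them. The guard on the last one is
-- needed: at `k = 0` that entry is 1, of degree 0. The outcome is that the discriminant is
-- nonconstant.
open Polynomial in
theorem transfer_degree [Nontrivial R] (v : ℤ → R) (n : ℤ) (k : ℕ) :
    (transfer X (fun m => C (v m)) n k 0 0).Monic ∧
    (transfer X (fun m => C (v m)) n k 0 0).degree = k ∧
    (transfer X (fun m => C (v m)) n k 1 0).degree < k ∧
    (transfer X (fun m => C (v m)) n k 0 1).degree < k ∧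
    (0 < k → (transfer X (fun m => C (v m)) n k 1 1).degree < k) := by
  induction k with
  | zero => simp [transfer]
  | succ k ih =>
    obtain ⟨h1, h2, h3, h4, h5⟩ := ih
    set a := transfer X (fun m => C (v m)) n k 0 0
    set c := transfer X (fun m => C (v m)) n k 1 0
    set b := transfer X (fun m => C (v m)) n k 0 1 with hb
    set d := transfer X (fun m => C (v m)) n k 1 1 with hd
    have ea : transfer X (fun m => C (v m)) n (k + 1) 0 0 = (X - C (v (n + k))) * a - c := by
      simp [transfer, stepMatrix, Matrix.mul_apply, Fin.sum_univ_two, a, c, sub_eq_add_neg]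
    have eb : transfer X (fun m => C (v m)) n (k + 1) 0 1 = (X - C (v (n + k))) * b - d := by
      simp [transfer, stepMatrix, Matrix.mul_apply, Fin.sum_univ_two, b, d, sub_eq_add_neg]
    have ec : transfer X (fun m => C (v m)) n (k + 1) 1 0 = a := by
      simp [transfer, stepMatrix, Matrix.mul_apply, Fin.sum_univ_two, a]
    have ed : transfer X (fun m => C (v m)) n (k + 1) 1 1 = b := by
      simp [transfer, stepMatrix, Matrix.mul_apply, Fin.sum_univ_two, b]
    rw [ea, eb, ec, ed]
    have hlt : ((k : ℕ) : WithBot ℕ) < ((k + 1 : ℕ) : WithBot ℕ) := by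
      exact_mod_cast k.lt_succ_self
    have hmon : ((X - C (v (n + k))) * a).Monic := (monic_X_sub_C _).mul h1
    have hdeg : ((X - C (v (n + k))) * a).degree = ((k + 1 : ℕ) : WithBot ℕ) := by
      rw [h1.degree_mul, degree_X_sub_C, h2]
      push_cast
      ring
    have hcd : c.degree < ((X - C (v (n + k))) * a).degree := by
      rw [hdeg]; exact h3.trans hlt
    refine ⟨hmon.sub_of_left hcd, ?_, ?_, ?_, fun _ => h4.trans hlt⟩
    · rw [degree_sub_eq_left_of_degree_lt hcd, hdeg]
    · rw [h2]; exact hlt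
    · refine (degree_sub_le _ _).trans_lt (max_lt ?_ ?_)
      · rcases eq_or_ne b 0 with h0 | h0
        · rw [h0, mul_zero, degree_zero]; exact WithBot.bot_lt_coe _
        · rw [Monic.degree_mul_comm (monic_X_sub_C _), (monic_X_sub_C _).degree_mul,
            degree_X_sub_C, degree_eq_natDegree h0]
          rw [degree_eq_natDegree h0] at h4
          have : b.natDegree < k := by exact_mod_cast h4
          exact_mod_cast (by omega : b.natDegree + 1 < k + 1)
      · rcases Nat.eq_zero_or_pos k with rfl | hk
        · simp [d, transfer]
        · exact (h5 hk).trans hlt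

open Polynomial in
theorem degree_trace_transfer [Nontrivial R] (v : ℤ → R) (n : ℤ) {k : ℕ} (hk : 0 < k) :
    (transfer X (fun m => C (v m)) n k).trace.degree = k := by
  obtain ⟨-, h2, -, -, h5⟩ := transfer_degree v n k
  rw [Matrix.trace_fin_two, degree_add_eq_left_of_degree_lt (by rw [h2]; exact h5 hk), h2]

end Transfer

/-! ### Elliptic monodromy and the creation of hyperbolic energies -/

/-- Cayley–Hamilton turns powers into the Chebyshev recursion, solved by sines; the factor `sin θ`
avoids a division. -/
theorem sin_smul_pow {M : Matrix (Fin 2) (Fin 2) ℝ} (hdet : M.det = 1) {θ : ℝ}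
    (hθ : M.trace = 2 * Real.cos θ) (k : ℕ) :
    Real.sin θ • M ^ k = Real.sin (k * θ) • M - Real.sin ((k - 1) * θ) • 1 := by
  have hsq : M * M = (2 * Real.cos θ) • M - 1 := by
    rw [Matrix.det_fin_two] at hdet
    rw [Matrix.trace_fin_two] at hθ
    rw [← hθ]
    ext i j
    fin_cases i <;> fin_cases j <;> simp [Matrix.mul_apply, Fin.sum_univ_two] <;> linarith
  induction k with
  | zero => simp
  | succ k ih =>
    rw [pow_succ, ← smul_mul_assoc, ih, sub_mul, smul_mul_assoc, hsq, smul_mul_assoc, one_mul]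
    have h1 : Real.sin ((k + 1 : ℕ) * θ) =
        Real.sin (k * θ) * (2 * Real.cos θ) - Real.sin ((k - 1) * θ) := by
      push_cast
      rw [add_mul, sub_mul, one_mul, Real.sin_add, Real.sin_sub]
      ring
    have h2 : ((k + 1 : ℕ) - 1 : ℝ) = k := by push_cast; ring
    rw [h1, h2]
    module

/-- Trace of a power of an elliptic matrix after multiplication by a lower unipotent. -/
theorem trace_pow_add {M : Matrix (Fin 2) (Fin 2) ℝ} (hdet : M.det = 1) {θ : ℝ}
    (hθ : M.trace = 2 * Real.cos θ) (hs : Real.sin θ ≠ 0) (k : ℕ) (ε : ℝ) :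
    (M ^ k).trace + ε * (M ^ k) 0 1 =
      2 * Real.cos (k * θ) + ε * (M 0 1 / Real.sin θ) * Real.sin (k * θ) := by
  have h := sin_smul_pow hdet hθ k
  have ht := congrArg Matrix.trace h
  have h01 := congrFun (congrFun h 0) 1
  simp only [Matrix.trace_smul, Matrix.trace_sub, Matrix.trace_one, Fintype.card_fin, hθ,
    Matrix.smul_apply, Matrix.sub_apply, smul_eq_mul] at ht h01
  rw [sub_mul, one_mul, Real.sin_sub] at ht
  simp only [ne_eq, zero_ne_one, not_false_eq_true, Matrix.one_apply_ne, mul_zero, sub_zero] at h01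
  have e1 : (M ^ k).trace = 2 * Real.cos (k * θ) := by
    apply mul_left_cancel₀ hs
    rw [ht]
    push_cast
    ring
  have e2 : (M ^ k) 0 1 = M 0 1 / Real.sin θ * Real.sin (k * θ) := by
    field_simp
    linarith
  rw [e1, e2]
  ring

theorem eval_transfer (E : ℝ) (v : ℤ → ℝ) (n : ℤ) (k : ℕ) (i j : Fin 2) :
    transfer E v n k i j =
      (transfer Polynomial.X (fun m => Polynomial.C (v m)) n k i j).eval E := by
  have h := transfer_map (Polynomial.evalRingHom E) Polynomial.X
    (fun m => Polynomial.C (v m)) n k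
  simp only [Polynomial.coe_evalRingHom, Polynomial.eval_X, Polynomial.eval_C] at h
  rw [← h]
  rfl

theorem eval_trace_transfer (E : ℝ) (v : ℤ → ℝ) (n : ℤ) (k : ℕ) :
    (transfer E v n k).trace =
      (transfer Polynomial.X (fun m => Polynomial.C (v m)) n k).trace.eval E := by
  rw [Matrix.trace_fin_two, Matrix.trace_fin_two, Polynomial.eval_add, eval_transfer,
    eval_transfer]

/-- The cosine loses at most φ², while the sine term gains at least 2φ² - φ⁴/3. -/
theorem two_lt_cos_add_sin {φ s : ℝ} (h0 : 0 < φ) (h1 : φ ≤ 1) (hs : 2 * φ ≤ s) :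
    2 < 2 * Real.cos φ + s * Real.sin φ := by
  have hc := Real.one_sub_sq_div_two_le_cos (x := φ)
  have hsin := Real.sin_gt_sub_cube h0
  have h2 : 2 * φ * (φ - φ ^ 3 / 6) ≤ s * Real.sin φ :=
    mul_le_mul hs hsin.le (by nlinarith [pow_le_one₀ h0.le h1 (n := 2)]) (by linarith)
  have h3 : φ ^ 2 * φ ^ 2 ≤ φ ^ 2 * 1 :=
    mul_le_mul_of_nonneg_left (pow_le_one₀ h0.le h1) (by positivity)
  nlinarith [pow_pos h0 2]

theorem exists_int_mem_Icc {x y φ c : ℝ} (hc : 0 < c) (h : x + c ≤ y) :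
    ∃ j : ℤ, φ + j * c ∈ Set.Icc x y := by
  refine ⟨⌈(x - φ) / c⌉, ?_, ?_⟩
  · have := Int.le_ceil ((x - φ) / c)
    rw [div_le_iff₀ hc] at this
    linarith
  · have := Int.ceil_lt_add_one ((x - φ) / c)
    have h2 := mul_lt_mul_of_pos_right this hc
    rw [add_mul, div_mul_cancel₀ _ hc.ne'] at h2
    linarith

theorem exists_int_mem_uIcc {x y φ c : ℝ} (hc : 0 < c) (h : c ≤ |x - y|) :
    ∃ j : ℤ, φ + j * c ∈ Set.uIcc x y := by
  rcases le_total x y with hxy | hxy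
  · rw [Set.uIcc_of_le hxy]
    rw [abs_of_nonpos (by linarith)] at h
    exact exists_int_mem_Icc hc (by linarith)
  · rw [Set.uIcc_of_ge hxy]
    rw [abs_of_nonneg (by linarith)] at h
    exact exists_int_mem_Icc hc (by linarith)

theorem finite_eval_eq {P : Polynomial ℝ} (hP : 0 < P.degree) (y : ℝ) :
    {x | P.eval x = y}.Finite := by
  have h : P - Polynomial.C y ≠ 0 := by
    intro h
    rw [sub_eq_zero.1 h] at hP
    exact absurd (Polynomial.degree_C_le (a := y)) (not_le.2 hP)
  refine (Polynomial.finite_setOfPred_isRoot h).subset fun x hx => ?_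
  simpa [sub_eq_zero] using hx

/-- A nonconstant polynomial bounded by `2` in modulus on an interval takes distinct values of
modulus less than `2` on a suitable subinterval. -/
theorem exists_subinterval {P : Polynomial ℝ} (hP : 0 < P.degree) {a b : ℝ} (hab : a < b)
    (h : ∀ x ∈ Set.Ioo a b, |P.eval x| ≤ 2) :
    ∃ c d, c < d ∧ Set.Icc c d ⊆ Set.Ioo a b ∧ (∀ x ∈ Set.Icc c d, |P.eval x| < 2) ∧
      P.eval c ≠ P.eval d := by
  obtain ⟨c, hc, hc'⟩ := (Set.Ioo_infinite hab).exists_notMem_finset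
    ((finite_eval_eq hP 2).union (finite_eval_eq hP (-2))).toFinset
  have hlt : |P.eval c| < 2 := by
    refine (h c hc).lt_of_ne fun he => hc' ?_
    rw [Set.Finite.mem_toFinset]
    exact eq_or_eq_neg_of_abs_eq he
  have hnhds : {x | x < b ∧ |P.eval x| < 2} ∈ 𝓝 c :=
    ((isOpen_gt' b).inter (isOpen_lt (P.continuous.abs) continuous_const)).mem_nhds ⟨hc.2, hlt⟩
  obtain ⟨e, he, hsub⟩ := exists_Ico_subset_of_mem_nhds hnhds (exists_gt c)
  obtain ⟨d, hd, hd'⟩ := (Set.Ioo_infinite he).exists_notMem_finset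
    (finite_eval_eq hP (P.eval c)).toFinset
  have hsub' : ∀ x ∈ Set.Icc c d, x < b ∧ |P.eval x| < 2 := fun x hx =>
    hsub ⟨hx.1, hx.2.trans_lt hd.2⟩
  refine ⟨c, d, hd.1, fun x hx => ⟨hc.1.trans_le hx.1, (hsub' x hx).1⟩,
    fun x hx => (hsub' x hx).2, fun heq => hd' ?_⟩
  rw [Set.Finite.mem_toFinset]
  exact heq.symm

/-- Either a periodic potential has an energy in `(a, b)` with hyperbolic monodromy, or, for every
large multiple of the period, a small change of the potential at one site produces one. -/
theorem exists_hyperbolic {v : ℤ → ℝ} {p : ℕ} (hp : 0 < p) {a b : ℝ} (hab : a < b) {ε : ℝ}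
    (hε : 0 < ε) (h : ∀ E ∈ Set.Ioo a b, |(transfer E v 0 p).trace| ≤ 2) :
    ∃ K : ℕ, ∀ k ≥ K, ∃ E ∈ Set.Ioo a b, ∃ δ : ℝ, |δ| ≤ ε ∧
      2 < |(transfer E v 0 p ^ k).trace + δ * (transfer E v 0 p ^ k) 0 1| := by
  have hdeg := degree_trace_transfer v 0 hp
  have hP : 0 < (transfer Polynomial.X (fun m => Polynomial.C (v m)) 0 p).trace.degree := by
    rw [hdeg]; exact_mod_cast hp
  simp only [eval_trace_transfer] at h
  obtain ⟨c, d, hcd, hsub, hlt, hne⟩ := exists_subinterval hP hab h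
  simp only [← eval_trace_transfer] at hlt hne
  have hcont : Continuous fun E => (transfer E v 0 p).trace := by
    simp only [eval_trace_transfer]; exact Polynomial.continuous _
  have hcont' : Continuous fun E => |transfer E v 0 p 0 1| := by
    simp only [eval_transfer]; exact (Polynomial.continuous _).abs
  set θ : ℝ → ℝ := fun E => Real.arccos ((transfer E v 0 p).trace / 2) with hθdef
  have hθc : Continuous θ := Real.continuous_arccos.comp (hcont.div_const 2)
  have hcos : ∀ E ∈ Set.Icc c d, (transfer E v 0 p).trace = 2 * Real.cos (θ E) := fun E hE => by
    have := abs_lt.1 (hlt E hE)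
    rw [hθdef, Real.cos_arccos (by linarith) (by linarith)]
    ring
  have hsin : ∀ E ∈ Set.Icc c d, 0 < Real.sin (θ E) := fun E hE => by
    have := abs_lt.1 (hlt E hE)
    rw [hθdef, Real.sin_arccos]
    apply Real.sqrt_pos.2
    nlinarith
  have hθne : 0 < |θ c - θ d| := by
    rw [abs_pos, sub_ne_zero]
    intro heq
    apply hne
    rw [hcos c ⟨le_rfl, hcd.le⟩, hcos d ⟨hcd.le, le_rfl⟩, heq]
  -- With a zero off-diagonal entry the diagonal entries would have product 1, forcing |trace| ≥ 2.
  have hoff : ∀ E ∈ Set.Icc c d, 0 < |transfer E v 0 p 0 1| := fun E hE => by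
    rw [abs_pos]
    intro h0
    have hdet := det_transfer E v 0 p
    have ht := abs_lt.1 (hlt E hE)
    rw [Matrix.det_fin_two, h0] at hdet
    rw [Matrix.trace_fin_two] at ht
    nlinarith [sq_nonneg (transfer E v 0 p 0 0 - transfer E v 0 p 1 1)]
  obtain ⟨E₀, hE₀, hmin⟩ := isCompact_Icc.exists_isMinOn ⟨c, le_rfl, hcd.le⟩ hcont'.continuousOn
  set m := |transfer E₀ v 0 p 0 1| with hm
  have hm0 : 0 < m := hoff E₀ hE₀
  -- Target angle for `two_lt_cos_add_sin`. Using the minimum `m` makes it independent of `E`, which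
  -- is found only afterwards.
  set φ := min 1 (ε * m / 2) with hφ
  have hφ0 : 0 < φ := lt_min one_pos (by positivity)
  have hφ1 : φ ≤ 1 := min_le_left _ _
  have hφ2 : 2 * φ ≤ ε * m := by
    have : φ ≤ ε * m / 2 := min_le_right _ _
    linarith
  -- From this `K` on, `k * θ` covers a length of at least 2π and so hits φ modulo 2π.
  obtain ⟨K, hK⟩ := exists_nat_ge (2 * Real.pi / |θ c - θ d|)
  refine ⟨K, fun k hk => ?_⟩
  have hk' : 2 * Real.pi ≤ |k * θ c - k * θ d| := by
    rw [div_le_iff₀ hθne] at hK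
    rw [← mul_sub, abs_mul, Nat.abs_cast]
    refine hK.trans (mul_le_mul_of_nonneg_right ?_ (abs_nonneg _))
    exact_mod_cast hk
  obtain ⟨j, hj⟩ := exists_int_mem_uIcc (φ := φ) Real.two_pi_pos hk'
  obtain ⟨E, hE, hEj⟩ := intermediate_value_uIcc
    (f := fun E => k * θ E) (a := c) (b := d) (by fun_prop) hj
  rw [Set.uIcc_of_le hcd.le] at hE
  simp only at hEj
  have hge : m ≤ |transfer E v 0 p 0 1| := hmin hE
  have hs0 := hsin E hE
  obtain ⟨δ, hδ, hδ'⟩ : ∃ δ : ℝ, |δ| ≤ ε ∧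
      δ * transfer E v 0 p 0 1 = ε * |transfer E v 0 p 0 1| := by
    rcases abs_choice (transfer E v 0 p 0 1) with h1 | h1
    · exact ⟨ε, (abs_of_pos hε).le, by rw [h1]⟩
    · exact ⟨-ε, by rw [abs_neg, abs_of_pos hε], by rw [h1]; ring⟩
  refine ⟨E, hsub hE, δ, hδ, lt_of_lt_of_le ?_ (le_abs_self _)⟩
  rw [trace_pow_add (det_transfer E v 0 p) (hcos E hE) hs0.ne', hEj, Real.cos_add_int_mul_two_pi,
    Real.sin_add_int_mul_two_pi]
  refine two_lt_cos_add_sin hφ0 hφ1 (hφ2.trans ?_)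
  rw [← mul_div_assoc, hδ', le_div_iff₀ hs0]
  have h1 : ε * m * Real.sin (θ E) ≤ ε * m * 1 :=
    mul_le_mul_of_nonneg_left (Real.sin_le_one _) (by positivity)
  have h2 := mul_le_mul_of_nonneg_left hge hε.le
  linarith

/-! ### Operators on ℓ²(ℤ) and energies outside the spectrum -/

theorem shift_apply (k : ℤ) (ψ : ℓ²(ℤ, ℂ)) (n : ℤ) : shift k ψ n = ψ (n + k) := rfl

theorem shift_add (j k : ℤ) : shift (j + k) = shift j * shift k := by
  ext ψ n
  simp only [mul_apply_eq_comp, shift_apply]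
  rw [add_assoc]

theorem shift_zero : shift 0 = 1 := by
  ext ψ n
  simp [shift_apply]

theorem shift_mul_shift_neg (k : ℤ) : shift k * shift (-k) = 1 := by
  rw [← shift_add, add_neg_cancel, shift_zero]

theorem shift_neg_mul_shift (k : ℤ) : shift (-k) * shift k = 1 := by
  rw [← shift_add, neg_add_cancel, shift_zero]

theorem norm_shift_le (k : ℤ) : ‖shift k‖ ≤ 1 :=
  LinearMap.mkContinuous_norm_le _ zero_le_one _

theorem norm_shift_apply (k : ℤ) (ψ : ℓ²(ℤ, ℂ)) : ‖shift k ψ‖ = ‖ψ‖ := by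
  refine le_antisymm (by simpa using (shift k).le_of_opNorm_le (norm_shift_le k) ψ) ?_
  have h : shift (-k) (shift k ψ) = ψ := by
    rw [← mul_apply_eq_comp, shift_neg_mul_shift, one_apply_eq_self]
  simpa [h] using (shift (-k)).le_of_opNorm_le (norm_shift_le (-k)) (shift k ψ)

theorem mulPotential_apply (V : ℓ^∞(ℤ, ℝ)) (ψ : ℓ²(ℤ, ℂ)) (n : ℤ) :
    mulPotential V ψ n = (V n : ℂ) * ψ n := rfl

theorem norm_mulPotential_le (V : ℓ^∞(ℤ, ℝ)) : ‖mulPotential V‖ ≤ ‖V‖ :=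
  lp.norm_mapCLM_le _ _ _ _

theorem schrodinger_sub (V W : ℓ^∞(ℤ, ℝ)) :
    schrodinger V - schrodinger W = mulPotential (V - W) := by
  ext ψ n
  simp only [sub_apply, lp.coeFn_sub, Pi.sub_apply, schrodinger_apply,
    mulPotential_apply]
  push_cast
  ring

theorem norm_schrodinger_sub_le (V W : ℓ^∞(ℤ, ℝ)) :
    ‖schrodinger V - schrodinger W‖ ≤ ‖V - W‖ := by
  rw [schrodinger_sub]
  exact norm_mulPotential_le _

theorem isSelfAdjoint_schrodinger (V : ℓ^∞(ℤ, ℝ)) : IsSelfAdjoint (schrodinger V) := by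
  have h1 : ∀ k : ℤ, ContinuousLinearMap.adjoint (shift k) = shift (-k) := fun k => by
    symm
    rw [ContinuousLinearMap.eq_adjoint_iff]
    intro x y
    rw [lp.inner_eq_tsum, lp.inner_eq_tsum, ← (Equiv.addRight k).tsum_eq]
    simp [shift_apply]
  have h2 : ContinuousLinearMap.adjoint (mulPotential V) = mulPotential V := by
    symm
    rw [ContinuousLinearMap.eq_adjoint_iff]
    intro x y
    rw [lp.inner_eq_tsum, lp.inner_eq_tsum]
    refine tsum_congr fun n => ?_
    simp [mulPotential_apply]
    ring
  rw [IsSelfAdjoint, ContinuousLinearMap.star_eq_adjoint, schrodinger, map_add, map_add, h1, h1,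
    h2, neg_neg, add_comm (shift (-1))]

/-- The standard basis vector at site `n`. -/
noncomputable def siteVector (n : ℤ) : ℓ²(ℤ, ℂ) := lp.single 2 n 1

theorem siteVector_apply (n m : ℤ) : siteVector n m = if m = n then 1 else 0 := by
  simp [siteVector, Pi.single_apply]

theorem siteVector_ne_zero (n : ℤ) : siteVector n ≠ 0 := fun h => by
  have := siteVector_apply n n
  rw [h] at this
  simp at this

instance : Nontrivial ℓ²(ℤ, ℂ) := ⟨siteVector 0, 0, siteVector_ne_zero 0⟩

theorem shift_siteVector (k n : ℤ) : shift k (siteVector n) = siteVector (n - k) := by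
  ext m
  simp [shift_apply, siteVector_apply, eq_sub_iff_add_eq]

theorem schrodinger_siteVector (V : ℓ^∞(ℤ, ℝ)) (n : ℤ) :
    schrodinger V (siteVector n) =
      siteVector (n + 1) + siteVector (n - 1) + (V n : ℂ) • siteVector n := by
  have h : mulPotential V (siteVector n) = (V n : ℂ) • siteVector n := by
    ext m
    rw [mulPotential_apply, lp.coeFn_smul, Pi.smul_apply, smul_eq_mul, siteVector_apply]
    by_cases hm : m = n
    · rw [hm]
    · simp [hm]
  rw [schrodinger, add_apply, add_apply, h,
    shift_siteVector, shift_siteVector, sub_neg_eq_add, add_comm (siteVector (n - 1))]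

theorem ext_siteVector {A B : ℓ²(ℤ, ℂ) →L[ℂ] ℓ²(ℤ, ℂ)}
    (h : ∀ n, A (siteVector n) = B (siteVector n)) : A = B := by
  refine lp.ext_continuousLinearMap (by simp) fun n => ?_
  ext1
  exact h n

/-- For a `p`-periodic potential the discriminant evaluated at `H` is `S ^ p + S ^ (-p)`. -/
theorem aeval_discriminant (V : ℓ^∞(ℤ, ℝ)) {p : ℕ} (hV : Function.Periodic V p) :
    Polynomial.aeval (schrodinger V)
      (transfer Polynomial.X (fun m => Polynomial.C (V m : ℂ)) 0 p).trace =
      shift p + shift (-p) := by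
  -- Let `X` act as `H`. The site vectors then solve the difference equation at energy `X`, and the
  -- formal discriminant identity applies to them.
  let _ : Module (Polynomial ℂ) ℓ²(ℤ, ℂ) := Module.compHom _
    (Polynomial.aeval (R := ℂ) (schrodinger V)).toRingHom
  have hsmul : ∀ (q : Polynomial ℂ) (ψ : ℓ²(ℤ, ℂ)),
      q • ψ = Polynomial.aeval (schrodinger V) q ψ := fun q ψ => rfl
  refine ext_siteVector fun n => ?_
  rw [← hsmul, discriminant_smul (u := siteVector) (fun m => ?_) (fun m => ?_) n,
    add_apply, shift_siteVector, shift_siteVector, sub_neg_eq_add, add_comm]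
  · rw [hsmul, hsmul, Polynomial.aeval_X, Polynomial.aeval_C, schrodinger_siteVector]
    rfl
  · simp only [hV m]

/-- An energy with hyperbolic monodromy is not in the spectrum. -/
theorem notMem_spectrum_of_hyperbolic (V : ℓ^∞(ℤ, ℝ)) {p : ℕ} (hV : Function.Periodic V p)
    {E : ℝ} (hE : 2 < |(transfer E V 0 p).trace|) : (E : ℂ) ∉ spectrum ℂ (schrodinger V) := by
  intro hmem
  set P := (transfer Polynomial.X (fun m => Polynomial.C (V m : ℂ)) 0 p).trace with hP
  -- Spectral mapping: Δ(E) lies in the spectrum of S^p + S^(-p), whose norm is at most 2.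
  have h1 := spectrum.subset_polynomial_aeval (schrodinger V) P ⟨_, hmem, rfl⟩
  rw [hP, aeval_discriminant V hV] at h1
  have h2 := spectrum.norm_le_norm_of_mem h1
  have h3 : ‖shift (p : ℤ) + shift (-p)‖ ≤ 2 :=
    (norm_add_le _ _).trans (by linarith [norm_shift_le p, norm_shift_le (-p)])
  have h4 : P.eval (E : ℂ) = ((transfer E V 0 p).trace : ℂ) := by
    have e1 := transfer_map (Polynomial.evalRingHom (E : ℂ)) Polynomial.X
      (fun m => Polynomial.C (V m : ℂ)) 0 p
    have e2 := transfer_map Complex.ofRealHom E V 0 p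
    simp only [Polynomial.coe_evalRingHom, Polynomial.eval_X, Polynomial.eval_C,
      Complex.ofRealHom_eq_coe] at e1 e2
    rw [← e2] at e1
    have e00 := congrFun (congrFun e1 0) 0
    have e11 := congrFun (congrFun e1 1) 1
    simp only [Matrix.map_apply] at e00 e11
    rw [hP, Matrix.trace_fin_two, Matrix.trace_fin_two, Polynomial.eval_add]
    push_cast
    exact congrArg₂ (· + ·) e00 e11
  simp only at h2
  rw [h4, Complex.norm_real, Real.norm_eq_abs] at h2
  linarith

/-! ### Absence of isolated points in the spectrum -/

theorem schrodinger_solution_eq_zero (V : ℓ^∞(ℤ, ℝ)) {z : ℂ} {ψ : ℓ²(ℤ, ℂ)}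
    (h : schrodinger V ψ = z • ψ) (h0 : ψ 0 = 0) (h1 : ψ 1 = 0) : ψ = 0 := by
  have hrec : ∀ n : ℤ, ψ (n + 1) + ψ (n - 1) + (V n : ℂ) * ψ n = z * ψ n := fun n => by
    rw [← schrodinger_apply, h, lp.coeFn_smul, Pi.smul_apply, smul_eq_mul]
  have key : ∀ n : ℤ, ψ n = 0 ∧ ψ (n + 1) = 0 := fun n => by
    induction n using Int.induction_on with
    | zero => exact ⟨h0, by rwa [zero_add]⟩
    | succ n ih =>
      refine ⟨ih.2, ?_⟩
      have := hrec (n + 1)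
      rwa [ih.2, add_sub_cancel_right, ih.1, mul_zero, mul_zero, add_zero, add_zero] at this
    | pred n ih =>
      rw [sub_add_cancel]
      refine ⟨?_, ih.1⟩
      have := hrec (-n)
      rwa [ih.1, ih.2, mul_zero, mul_zero, add_zero, zero_add] at this
  ext n
  exact (key n).1

/-- An eigenvector is controlled by two of its values. -/
theorem exists_norm_le_of_eigenvector (V : ℓ^∞(ℤ, ℝ)) (z : ℂ) :
    ∃ C : ℝ, 0 ≤ C ∧ ∀ ψ : ℓ²(ℤ, ℂ), schrodinger V ψ = z • ψ →
      ‖ψ‖ ≤ C * max ‖ψ 0‖ ‖ψ 1‖ := by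
  let N : Submodule ℂ ℓ²(ℤ, ℂ) := LinearMap.ker
    ((schrodinger V - z • (1 : ℓ²(ℤ, ℂ) →L[ℂ] ℓ²(ℤ, ℂ))) : ℓ²(ℤ, ℂ) →ₗ[ℂ] ℓ²(ℤ, ℂ))
  have hN : ∀ ψ : ℓ²(ℤ, ℂ), ψ ∈ N ↔ schrodinger V ψ = z • ψ := fun ψ => by
    simp [N, sub_eq_zero]
  let L : N →ₗ[ℂ] ℂ × ℂ :=
    { toFun := fun ψ => ((ψ : ℓ²(ℤ, ℂ)) 0, (ψ : ℓ²(ℤ, ℂ)) 1)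
      map_add' := fun _ _ => rfl
      map_smul' := fun _ _ => rfl }
  have hker : LinearMap.ker L = ⊥ := by
    rw [LinearMap.ker_eq_bot']
    intro ψ hψ
    exact Subtype.ext (schrodinger_solution_eq_zero V ((hN _).1 ψ.2)
      (congrArg Prod.fst hψ) (congrArg Prod.snd hψ))
  -- Evaluation at the sites 0 and 1 is injective on the eigenspace; in finite dimension it is then
  -- bounded below.
  have : FiniteDimensional ℂ N := FiniteDimensional.of_injective L (LinearMap.ker_eq_bot.1 hker)
  obtain ⟨K, -, hK⟩ := L.exists_antilipschitzWith hker
  refine ⟨K, K.2, fun ψ hψ => ?_⟩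
  have := hK.le_mul_dist ⟨ψ, (hN ψ).2 hψ⟩ 0
  rw [map_zero, dist_zero_right, dist_zero_right] at this
  exact this

theorem finite_le_norm_apply (ψ : ℓ²(ℤ, ℂ)) {η : ℝ} (hη : 0 < η) :
    {n | η ≤ ‖ψ n‖}.Finite := by
  have hs : Summable fun n => ‖ψ n‖ ^ (2 : ℝ≥0∞).toReal := (lp.memℓp ψ).summable (by norm_num)
  have h := hs.tendsto_cofinite_zero.eventually_lt_const
    (show (0 : ℝ) < η ^ (2 : ℝ≥0∞).toReal by positivity)
  refine (Filter.eventually_cofinite.1 h).subset fun n hn => ?_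
  simp only [Set.mem_ofPred_eq, not_lt] at hn ⊢
  exact Real.rpow_le_rpow hη.le hn (by norm_num)

/-- Riesz projection at an isolated point of the spectrum of a normal element. -/
theorem exists_spectral_projection {A : Type*} [CStarAlgebra A] {a : A} [IsStarNormal a] {z : ℂ}
    (hz : z ∈ spectrum ℂ a) (h : ¬ AccPt z (Filter.principal (spectrum ℂ a))) :
    ∃ P g : A, P ≠ 0 ∧ (a - algebraMap ℂ A z) * P = 0 ∧ g * (a - algebraMap ℂ A z) = 1 - P := by
  rw [accPt_iff_nhds] at h
  push Not at h
  obtain ⟨U, hU, hUz⟩ := h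
  have hev : ∀ᶠ x in 𝓝[spectrum ℂ a] z, x = z := by
    filter_upwards [mem_nhdsWithin_of_mem_nhds hU, self_mem_nhdsWithin] with x hx hx'
    exact hUz x ⟨hx, hx'⟩
  have hP : ContinuousOn (fun x : ℂ => if x = z then (1 : ℂ) else 0) (spectrum ℂ a) := by
    intro x hx
    rcases eq_or_ne x z with rfl | hxz
    · refine ContinuousWithinAt.congr_of_eventuallyEq
        (continuousWithinAt_const (b := (1 : ℂ))) ?_ (by simp)
      filter_upwards [hev] with y hy
      simp [hy]
    · refine ContinuousAt.continuousWithinAt (ContinuousAt.congr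
        (continuousAt_const (y := (0 : ℂ))) ?_)
      filter_upwards [isOpen_ne.mem_nhds hxz] with y hy
      rw [if_neg hy]
  -- Since `0⁻¹ = 0`, this function times `x - z` is exactly 1 minus the indicator of `z`; isolation
  -- of `z` gives continuity there.
  have hg : ContinuousOn (fun x : ℂ => (x - z)⁻¹) (spectrum ℂ a) := by
    intro x hx
    rcases eq_or_ne x z with rfl | hxz
    · refine ContinuousWithinAt.congr_of_eventuallyEq
        (continuousWithinAt_const (b := (0 : ℂ))) ?_ (by simp)
      filter_upwards [hev] with y hy
      simp [hy]
    · exact ((continuousAt_id.sub continuousAt_const).inv₀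
        (sub_ne_zero.2 hxz)).continuousWithinAt
  have hid : a - algebraMap ℂ A z = cfc (fun x : ℂ => x - z) a := by
    rw [cfc_sub (fun x : ℂ => x) (fun _ => z) a, cfc_id' ℂ a, cfc_const z a]
  refine ⟨cfc (fun x : ℂ => if x = z then (1 : ℂ) else 0) a, cfc (fun x : ℂ => (x - z)⁻¹) a,
    ?_, ?_, ?_⟩
  · intro h0
    rw [← cfc_const_zero ℂ a] at h0
    simpa using eqOn_of_cfc_eq_cfc h0 hP (by fun_prop) (by assumption) hz
  · rw [hid, ← cfc_mul _ _ a (by fun_prop) hP, ← cfc_const_zero ℂ a]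
    refine cfc_congr fun x _ => ?_
    by_cases hx : x = z <;> simp [hx]
  · rw [hid, ← cfc_mul _ _ a hg (by fun_prop), ← cfc_const_one ℂ a,
      ← cfc_sub _ _ a (by fun_prop) hP]
    refine cfc_congr fun x _ => ?_
    by_cases hx : x = z
    · simp [hx]
    · simp [hx, inv_mul_cancel₀ (sub_ne_zero.2 hx)]

/-- If `H` almost commutes with infinitely many translations, its spectrum has no isolated
points. -/
theorem accPt_spectrum (V : ℓ^∞(ℤ, ℝ))
    (hrec : ∀ δ > 0, ∀ F : Set ℤ, F.Finite →
      ∃ n ∉ F, ‖schrodinger V * shift n - shift n * schrodinger V‖ < δ)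
    {z : ℂ} (hz : z ∈ spectrum ℂ (schrodinger V)) :
    AccPt z (Filter.principal (spectrum ℂ (schrodinger V))) := by
  by_contra hacc
  have : IsStarNormal (schrodinger V) := (isSelfAdjoint_schrodinger V).isStarNormal
  obtain ⟨P, g, hP, hHP, hgH⟩ := exists_spectral_projection hz hacc
  have heig : ∀ x, schrodinger V (P x) = z • P x := fun x => by
    have := DFunLike.congr_fun hHP x
    simpa [sub_eq_zero, Algebra.algebraMap_eq_smul_one] using this
  obtain ⟨x, hx⟩ : ∃ x, P x ≠ 0 := by
    by_contra! h
    exact hP (ContinuousLinearMap.ext h)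
  obtain ⟨C, hC, hCle⟩ := exists_norm_le_of_eigenvector V z
  set ψ := P x with hψ
  have hψ0 : 0 < ‖ψ‖ := norm_pos_iff.2 hx
  -- δ and η make each of the two errors, (C + 1)‖g‖δ‖ψ‖ and Cη, at most ‖ψ‖/4.
  set δ := 1 / (4 * (‖g‖ + 1) * (C + 1)) with hδ
  set η := ‖ψ‖ / (4 * (C + 1)) with hη
  have hη0 : 0 < η := by positivity
  have hfin := finite_le_norm_apply ψ hη0
  have hfin' : {n | η ≤ ‖ψ (1 + n)‖}.Finite :=
    hfin.preimage (f := fun n => 1 + n) (add_right_injective (1 : ℤ)).injOn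
  -- Avoiding a finite set of `n` makes the translated eigenvector smaller than η at both sites 0
  -- and 1.
  obtain ⟨n, hn, hcomm⟩ := hrec δ (by positivity) _ (hfin.union hfin')
  simp only [Set.mem_union, Set.mem_ofPred_eq, not_or, not_le] at hn
  set φ := shift n ψ with hφ
  have h1 : ‖φ - P φ‖ ≤ ‖g‖ * (δ * ‖ψ‖) := by
    have e1 : φ - P φ = g (schrodinger V φ - z • φ) := by
      have := DFunLike.congr_fun hgH φ
      simpa [Algebra.algebraMap_eq_smul_one] using this.symm
    have e2 : schrodinger V φ - z • φ =
        (schrodinger V * shift n - shift n * schrodinger V) ψ := by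
      simp [hφ, hψ, heig]
    rw [e1, e2]
    exact (g.le_opNorm _).trans (mul_le_mul_of_nonneg_left
      (ContinuousLinearMap.le_of_opNorm_le _ hcomm.le _) (norm_nonneg _))
  have hδ' : (‖g‖ * (δ * ‖ψ‖)) * (C + 1) ≤ ‖ψ‖ / 4 := by
    have : (‖g‖ * (δ * ‖ψ‖)) * (C + 1) = ‖g‖ / (‖g‖ + 1) * (‖ψ‖ / 4) := by
      rw [hδ]; field_simp
    rw [this]
    exact mul_le_of_le_one_left (by positivity)
      ((div_le_one (by positivity)).2 (by linarith))
  have hη' : C * η ≤ ‖ψ‖ / 4 := by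
    have : C * η = C / (C + 1) * (‖ψ‖ / 4) := by rw [hη]; field_simp
    rw [this]
    exact mul_le_of_le_one_left (by positivity)
      ((div_le_one (by positivity)).2 (by linarith))
  have hcoord : ∀ m : ℤ, ‖φ m‖ < η → ‖P φ m‖ ≤ η + ‖g‖ * (δ * ‖ψ‖) := fun m hm => by
    have e : P φ m = φ m - (φ - P φ) m := by simp
    rw [e]
    refine (norm_sub_le _ _).trans (add_le_add hm.le ?_)
    exact (lp.norm_apply_le_norm (by simp) _ m).trans h1
  have h2 : ‖P φ‖ ≤ C * (η + ‖g‖ * (δ * ‖ψ‖)) :=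
    (hCle _ (heig φ)).trans (mul_le_mul_of_nonneg_left (max_le
      (hcoord 0 (by rw [hφ, shift_apply, zero_add]; exact hn.1))
      (hcoord 1 (by rw [hφ, shift_apply]; exact hn.2))) hC)
  have h3 : ‖ψ‖ ≤ ‖φ - P φ‖ + ‖P φ‖ := by
    rw [← norm_shift_apply n ψ, ← hφ]
    simpa using norm_add_le (φ - P φ) (P φ)
  -- The bounds combine to ‖ψ‖ ≤ (C + 1)‖g‖δ‖ψ‖ + Cη ≤ ‖ψ‖/2, a contradiction.
  nlinarith

/-! ### Covariance, recurrence and independence of the phase -/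

theorem zpow_add_apply {Ω : Type*} [TopologicalSpace Ω] (T : Ω ≃ₜ Ω) (m n : ℤ) (ω : Ω) :
    (T ^ (m + n)) ω = (T ^ m) ((T ^ n) ω) := by
  rw [zpow_add]; rfl

section Dynamics

variable {Ω : Type*} [TopologicalSpace Ω] [CompactSpace Ω] (T : Ω ≃ₜ Ω)

theorem potential_apply (f : C(Ω, ℝ)) (ω : Ω) (n : ℤ) : potential T f ω n = f ((T ^ n) ω) := rfl

theorem norm_potential_sub_le (f g : C(Ω, ℝ)) (ω : Ω) :
    ‖potential T f ω - potential T g ω‖ ≤ ‖f - g‖ :=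
  lp.norm_le_of_forall_le (norm_nonneg _) fun n => (f - g).norm_coe_le_norm ((T ^ n) ω)

theorem continuous_schrodinger_potential (ω : Ω) :
    Continuous fun f : C(Ω, ℝ) => schrodinger (potential T f ω) :=
  (LipschitzWith.of_dist_le_mul (K := 1) fun f g => by
    rw [dist_eq_norm, dist_eq_norm, NNReal.coe_one, one_mul]
    exact (norm_schrodinger_sub_le _ _).trans (norm_potential_sub_le T f g ω)).continuous

theorem shift_mul_schrodinger (f : C(Ω, ℝ)) (ω : Ω) (n : ℤ) :
    shift n * schrodinger (potential T f ω) =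
      schrodinger (potential T f ((T ^ n) ω)) * shift n := by
  ext ψ m
  rw [mul_apply_eq_comp, mul_apply_eq_comp, shift_apply, schrodinger_apply, schrodinger_apply,
    shift_apply, shift_apply, shift_apply, potential_apply, potential_apply, zpow_add_apply,
    add_right_comm m n 1, add_sub_right_comm m n 1]

/-- The translation by `n` as an invertible operator. -/
noncomputable def shiftUnit (n : ℤ) : (ℓ²(ℤ, ℂ) →L[ℂ] ℓ²(ℤ, ℂ))ˣ :=
  ⟨shift n, shift (-n), shift_mul_shift_neg n, shift_neg_mul_shift n⟩

theorem spectrum_potential_zpow (f : C(Ω, ℝ)) (ω : Ω) (n : ℤ) :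
    spectrum ℂ (schrodinger (potential T f ((T ^ n) ω))) =
      spectrum ℂ (schrodinger (potential T f ω)) := by
  have h : schrodinger (potential T f ((T ^ n) ω)) =
      (shiftUnit n : ℓ²(ℤ, ℂ) →L[ℂ] ℓ²(ℤ, ℂ)) * schrodinger (potential T f ω) *
        ((shiftUnit n)⁻¹ : (ℓ²(ℤ, ℂ) →L[ℂ] ℓ²(ℤ, ℂ))ˣ) := by
    change _ = shift n * _ * shift (-n)
    rw [shift_mul_schrodinger, mul_assoc, shift_mul_shift_neg, mul_one]
  rw [h, spectrum.units_conjugate]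

end Dynamics

theorem zpow_apply_of_translation {Ω : Type*} [AddCommGroup Ω] [TopologicalSpace Ω]
    {T : Ω ≃ₜ Ω} {α : Ω} (hT : ∀ ω, T ω = ω + α) (n : ℤ) (ω : Ω) :
    (T ^ n) ω = ω + n • α := by
  have hnat : ∀ (k : ℕ) (ω : Ω), (T ^ k) ω = ω + (k : ℤ) • α := fun k => by
    induction k with
    | zero => intro ω; simp
    | succ k ih =>
      intro ω
      rw [pow_succ]
      change (T ^ k) (T ω) = _
      rw [ih, hT, Nat.cast_succ, add_smul, one_smul]
      abel
  obtain ⟨k, rfl | rfl⟩ := n.eq_nat_or_neg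
  · rw [zpow_natCast, hnat]
  · have h := hnat k ((T ^ (-(k : ℤ))) ω)
    rw [← zpow_natCast, ← zpow_add_apply, add_neg_cancel, zpow_zero] at h
    change ω = _ at h
    rw [neg_smul, ← sub_eq_add_neg, eq_sub_iff_add_eq, ← h]

section Translation

variable {Ω : Type*} [AddCommGroup Ω] [TopologicalSpace Ω] [IsTopologicalAddGroup Ω]

/-- The translates of a continuous function, as a continuous family. -/
def translates (f : C(Ω, ℝ)) : C(Ω, C(Ω, ℝ)) :=
  ContinuousMap.curry ⟨fun x => f (x.1 + x.2), by fun_prop⟩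

theorem translates_apply (f : C(Ω, ℝ)) (ω x : Ω) : translates f ω x = f (ω + x) := rfl

theorem translates_zero (f : C(Ω, ℝ)) : translates f 0 = f := by
  ext x
  rw [translates_apply, zero_add]

variable [CompactSpace Ω] {T : Ω ≃ₜ Ω}

/-- Moves the phase into the sampling function, so that norm continuity in ω follows from that of ω
↦ `translates f ω`. -/
theorem potential_eq_translates (hT : IsTranslation T) (f : C(Ω, ℝ)) (ω : Ω) :
    potential T f ω = potential T (translates f ω) 0 := by
  obtain ⟨α, hα⟩ := hT
  ext n
  rw [potential_apply, potential_apply, translates_apply, zpow_apply_of_translation hα,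
    zpow_apply_of_translation hα, zero_add]

theorem continuous_schrodinger_phase (hT : IsTranslation T) (f : C(Ω, ℝ)) :
    Continuous fun ω => schrodinger (potential T f ω) := by
  simp_rw [potential_eq_translates hT f]
  exact (continuous_schrodinger_potential T 0).comp (translates f).continuous

/-- The phases at which `z` is in the resolvent set form an open set, which a dense orbit must meet;
along an orbit the operators are unitarily equivalent. -/
theorem spectrum_subset (hT : IsTranslation T) (hmin : IsMinimalHomeo T) (f : C(Ω, ℝ))
    (ω ω' : Ω) : spectrum ℂ (schrodinger (potential T f ω')) ⊆
      spectrum ℂ (schrodinger (potential T f ω)) := by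
  intro z hz hunit
  have hopen : IsOpen {ω | IsUnit (algebraMap ℂ (ℓ²(ℤ, ℂ) →L[ℂ] ℓ²(ℤ, ℂ)) z -
      schrodinger (potential T f ω))} :=
    Units.isOpen.preimage (continuous_const.sub (continuous_schrodinger_phase hT f))
  obtain ⟨_, ⟨n, rfl⟩, hx⟩ := (hmin ω').exists_mem_open hopen ⟨ω, hunit⟩
  rw [← spectrum_potential_zpow T f ω' n] at hz
  exact hz hx

theorem spectrum_eq (hT : IsTranslation T) (hmin : IsMinimalHomeo T) (f : C(Ω, ℝ)) (ω ω' : Ω) :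
    spectrum ℂ (schrodinger (potential T f ω)) = spectrum ℂ (schrodinger (potential T f ω')) :=
  (spectrum_subset hT hmin f ω' ω).antisymm (spectrum_subset hT hmin f ω ω')

/-- By covariance the commutator with `shift n` is at most the distance from `H` at ω to `H` at `T ^
n` ω. In a perfect space a dense orbit stays dense without finitely many points, so small distances
occur for `n` outside any finite set. -/
theorem accPt_spectrum_potential [T1Space Ω] [PerfectSpace Ω] (hT : IsTranslation T)
    (hmin : IsMinimalHomeo T) (f : C(Ω, ℝ)) (ω : Ω) {z : ℂ}
    (hz : z ∈ spectrum ℂ (schrodinger (potential T f ω))) :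
    AccPt z (Filter.principal (spectrum ℂ (schrodinger (potential T f ω)))) := by
  refine accPt_spectrum _ (fun δ hδ F hF => ?_) hz
  have hopen : IsOpen {ω' | ‖schrodinger (potential T f ω) - schrodinger (potential T f ω')‖ < δ} :=
    isOpen_lt (continuous_const.sub (continuous_schrodinger_phase hT f)).norm continuous_const
  obtain ⟨_, hx, ⟨n, rfl⟩, hn⟩ := ((hmin ω).sdiff_finite
    (hF.image fun n : ℤ => (T ^ n) ω)).inter_open_nonempty _ hopen ⟨ω, by simpa using hδ⟩
  refine ⟨n, fun h => hn ⟨n, h, rfl⟩, ?_⟩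
  rw [shift_mul_schrodinger, ← sub_mul]
  refine (norm_mul_le _ _).trans_lt (lt_of_le_of_lt ?_ hx)
  exact mul_le_of_le_one_right (norm_nonneg _) (norm_shift_le n)

end Translation

/-! ### Finite quotients and density of gaps -/

theorem addOrderOf_dvd_iff_smul_mem {Ω : Type*} [AddCommGroup Ω] [TopologicalSpace Ω]
    (V : OpenAddSubgroup Ω) (α : Ω) (n : ℕ) :
    addOrderOf (QuotientAddGroup.mk α : Ω ⧸ V.toAddSubgroup) ∣ n ↔ n • α ∈ V := by
  rw [addOrderOf_dvd_iff_nsmul_eq_zero]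
  exact QuotientAddGroup.eq_zero_iff (N := V.toAddSubgroup) (n • α)

/-- A finite dense orbit would remain dense after removing all its points. -/
theorem not_isOfFinAddOrder {Ω : Type*} [AddCommGroup Ω] [TopologicalSpace Ω] [T1Space Ω]
    [PerfectSpace Ω] {T : Ω ≃ₜ Ω} {α : Ω} (hα : ∀ ω, T ω = ω + α) (hmin : IsMinimalHomeo T) : ¬ IsOfFinAddOrder α := by
  intro h
  have hfin : (Set.range fun n : ℤ => (T ^ n) (0 : Ω)).Finite := by
    refine (finite_zmultiples.2 h).subset ?_
    rintro _ ⟨n, rfl⟩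
    exact ⟨n, by simp [zpow_apply_of_translation hα]⟩
  have := ((hmin 0).sdiff_finite hfin).nonempty
  simp at this

section Density

variable {Ω : Type*} [AddCommGroup Ω] [TopologicalSpace Ω] [IsTopologicalAddGroup Ω]

/-- The continuous function on `Ω` induced by a function on a finite quotient. -/
def quotientFunction (V : OpenAddSubgroup Ω) (h : Ω ⧸ V.toAddSubgroup → ℝ) : C(Ω, ℝ) :=
  ⟨fun x => h (QuotientAddGroup.mk x),
    (continuous_of_discreteTopology (f := h)).comp QuotientAddGroup.continuous_mk⟩

theorem quotientFunction_apply (V : OpenAddSubgroup Ω) (h : Ω ⧸ V.toAddSubgroup → ℝ) (x : Ω) :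
    quotientFunction V h x = h (QuotientAddGroup.mk x) := rfl

variable [CompactSpace Ω]

theorem exists_openAddSubgroup_subset [TotallyDisconnectedSpace Ω] {U : Set Ω} (hU : U ∈ 𝓝 0) :
    ∃ V : OpenAddSubgroup Ω, (V : Set Ω) ⊆ U := by
  obtain ⟨W, hW, h0, hWU⟩ := compact_exists_isClopen_in_isOpen isOpen_interior
    (mem_interior_iff_mem_nhds.2 hU)
  obtain ⟨V, hV⟩ := IsTopologicalAddGroup.exist_openAddSubgroup_sub_clopen_nhds_of_zero hW h0
  exact ⟨V, hV.trans (hWU.trans interior_subset)⟩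

theorem norm_quotientFunction_out_sub_le (f : C(Ω, ℝ)) (V : OpenAddSubgroup Ω) {ε : ℝ}
    (hε : 0 ≤ ε) (hV : ∀ u ∈ V, ‖translates f u - f‖ ≤ ε) :
    ‖quotientFunction V (fun q => f q.out) - f‖ ≤ ε := by
  refine (ContinuousMap.norm_le _ hε).2 fun x => ?_
  obtain ⟨u, hu⟩ := QuotientAddGroup.mk_out_eq_add V.toAddSubgroup x
  rw [ContinuousMap.sub_apply, quotientFunction_apply, hu, add_comm, ← translates_apply,
    ← ContinuousMap.sub_apply]
  exact (ContinuousMap.norm_coe_le_norm _ _).trans (hV u u.2)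

variable {T : Ω ≃ₜ Ω} {α : Ω}

theorem potential_quotientFunction (hα : ∀ ω, T ω = ω + α) (V : OpenAddSubgroup Ω)
    (h : Ω ⧸ V.toAddSubgroup → ℝ) (n : ℤ) :
    potential T (quotientFunction V h) 0 n = h (n • (QuotientAddGroup.mk α)) := by
  rw [potential_apply, quotientFunction_apply, zpow_apply_of_translation hα, zero_add]
  rfl

theorem periodic_potential_quotientFunction (hα : ∀ ω, T ω = ω + α) (V : OpenAddSubgroup Ω)
    (h : Ω ⧸ V.toAddSubgroup → ℝ) {N : ℕ} (hN : N • α ∈ V) :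
    Function.Periodic (potential T (quotientFunction V h) 0) (N : ℤ) := fun n => by
  rw [potential_quotientFunction hα, potential_quotientFunction hα, add_smul]
  congr 1
  have : (N : ℤ) • (QuotientAddGroup.mk α : Ω ⧸ V.toAddSubgroup) = 0 := by
    rw [natCast_zsmul]
    exact (QuotientAddGroup.eq_zero_iff (N := V.toAddSubgroup) (N • α)).2 hN
  rw [this, add_zero]

theorem addOrderOf_pos_quotient (V : OpenAddSubgroup Ω) (α : Ω) :
    0 < addOrderOf (QuotientAddGroup.mk α : Ω ⧸ V.toAddSubgroup) :=
  addOrderOf_pos _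

/-- There are open subgroups inside any neighbourhood in which `α` has arbitrarily large order. -/
theorem exists_openAddSubgroup_order [TotallyDisconnectedSpace Ω] [T1Space Ω] [PerfectSpace Ω]
    (hα : ∀ ω, T ω = ω + α) (hmin : IsMinimalHomeo T) {U : Set Ω} (hU : U ∈ 𝓝 0) (m : ℕ) :
    ∃ V : OpenAddSubgroup Ω, (V : Set Ω) ⊆ U ∧
      m < addOrderOf (QuotientAddGroup.mk α : Ω ⧸ V.toAddSubgroup) := by
  -- A subgroup avoiding α, ..., mα gives α an order above `m`; 0 is not among these multiples as α
  -- has infinite order.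
  have hF : ((fun j : ℕ => j • α) '' Set.Icc 1 m)ᶜ ∈ 𝓝 (0 : Ω) := by
    refine (((Set.finite_Icc 1 m).image _).isClosed.isOpen_compl).mem_nhds ?_
    rintro ⟨j, hj, h0⟩
    exact not_isOfFinAddOrder hα hmin (isOfFinAddOrder_iff_nsmul_eq_zero.2 ⟨j, hj.1, h0⟩)
  obtain ⟨V, hV⟩ := exists_openAddSubgroup_subset (Filter.inter_mem hU hF)
  refine ⟨V, fun x hx => (hV hx).1, ?_⟩
  by_contra! hle
  have hmem := (addOrderOf_dvd_iff_smul_mem V α _).1 dvd_rfl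
  exact (hV hmem).2 ⟨_, ⟨addOrderOf_pos_quotient V α, hle⟩, rfl⟩

/-- Every sampling function can be approximated by one whose spectrum misses a point of a given
interval. -/
theorem exists_approx_notMem_spectrum [TotallyDisconnectedSpace Ω] [T1Space Ω] [PerfectSpace Ω]
    (hα : ∀ ω, T ω = ω + α) (hmin : IsMinimalHomeo T) (f : C(Ω, ℝ)) {ε : ℝ} (hε : 0 < ε)
    {a b : ℝ} (hab : a < b) :
    ∃ g : C(Ω, ℝ), ‖g - f‖ ≤ ε ∧
      ∃ E ∈ Set.Ioo a b, (E : ℂ) ∉ spectrum ℂ (schrodinger (potential T g 0)) := by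
  have hU : {u | ‖translates f u - f‖ < ε / 2} ∈ 𝓝 (0 : Ω) :=
    (isOpen_lt ((translates f).continuous.sub continuous_const).norm continuous_const).mem_nhds
      (by simp [translates_zero, hε])
  obtain ⟨V, hV⟩ := exists_openAddSubgroup_subset hU
  set g₀ := quotientFunction V (fun q => f q.out) with hg₀
  have hg₀f : ‖g₀ - f‖ ≤ ε / 2 :=
    norm_quotientFunction_out_sub_le f V (by positivity) fun u hu => (hV hu).le
  set p := addOrderOf (QuotientAddGroup.mk α : Ω ⧸ V.toAddSubgroup) with hp
  have hp0 : 0 < p := addOrderOf_pos_quotient V α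
  have hper : Function.Periodic (potential T g₀ 0) (p : ℤ) :=
    periodic_potential_quotientFunction hα V _ ((addOrderOf_dvd_iff_smul_mem V α p).1 dvd_rfl)
  by_cases hhyp : ∃ E ∈ Set.Ioo a b, 2 < |(transfer E (potential T g₀ 0) 0 p).trace|
  · obtain ⟨E, hE, hE2⟩ := hhyp
    exact ⟨g₀, by linarith, E, hE, notMem_spectrum_of_hyperbolic _ hper hE2⟩
  push Not at hhyp
  obtain ⟨K, hK⟩ := exists_hyperbolic hp0 hab (half_pos hε) hhyp
  -- Inside `V` the new order is a multiple `k * p`, and exceeding `K * p` forces `k ≥ K`.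
  obtain ⟨V', hV'V, hN⟩ := exists_openAddSubgroup_order hα hmin (V.mem_nhds_zero) (K * p)
  set N := addOrderOf (QuotientAddGroup.mk α : Ω ⧸ V'.toAddSubgroup) with hNdef
  have hNV' : N • α ∈ V' := (addOrderOf_dvd_iff_smul_mem V' α N).1 dvd_rfl
  obtain ⟨k, hk⟩ : p ∣ N := (addOrderOf_dvd_iff_smul_mem V α N).2 (hV'V hNV')
  rw [mul_comm] at hk
  have hkK : K ≤ k := by
    rw [hk] at hN
    exact (lt_of_mul_lt_mul_right hN (Nat.zero_le p)).le
  obtain ⟨E, hE, δ, hδ, htr⟩ := hK k hkK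
  classical
  -- δ times the indicator of `V'`: along the orbit of 0 it affects only the multiples of `N`, one
  -- site per period.
  set s := quotientFunction V' (fun q => if q = 0 then δ else 0) with hs
  have hsn : ‖s‖ ≤ ε / 2 := (ContinuousMap.norm_le _ (by positivity)).2 fun x => by
    rw [hs, quotientFunction_apply]
    split_ifs
    · exact hδ
    · simpa using (half_pos hε).le
  have hsum : ∀ n : ℤ, potential T (g₀ + s) 0 n = potential T g₀ 0 n + potential T s 0 n :=
    fun n => rfl
  have hsval : ∀ n : ℤ, potential T s 0 n = if (N : ℤ) ∣ n then δ else 0 := fun n => by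
    rw [hs, potential_quotientFunction hα]
    simp only [hNdef, addOrderOf_dvd_iff_zsmul_eq_zero]
  have hperN : Function.Periodic (potential T (g₀ + s) 0) (N : ℤ) := fun n => by
    rw [hsum, hsum, periodic_potential_quotientFunction hα V' _ hNV' n,
      periodic_potential_quotientFunction hα V _ (hV'V hNV') n]
  refine ⟨g₀ + s, ?_, E, hE, notMem_spectrum_of_hyperbolic _ hperN ?_⟩
  · calc ‖g₀ + s - f‖ = ‖(g₀ - f) + s‖ := by rw [add_sub_right_comm]
      _ ≤ ε := (norm_add_le _ _).trans (by linarith)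
  · rw [trace_transfer_perturb (v := potential T g₀ 0) (ε := δ) ?_ ?_
      (addOrderOf_pos_quotient V' α)]
    · rw [← hNdef, hk, transfer_mul hper]
      exact htr
    · rw [hsum, hsval, if_pos (dvd_zero _)]
    · intro j hj hjN
      rw [hsum, hsval, if_neg, add_zero]
      rw [zero_add, Int.natCast_dvd_natCast]
      exact Nat.not_dvd_of_pos_of_lt hj hjN

end Density

/-! ### The dense Gδ set -/

/-- The sampling functions for which some point of `(a, b)` is outside the spectrum. -/
def gapSet {Ω : Type*} [AddCommGroup Ω] [TopologicalSpace Ω] [CompactSpace Ω] (T : Ω ≃ₜ Ω)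
    (a b : ℝ) : Set C(Ω, ℝ) :=
  {f | ∃ E ∈ Set.Ioo a b, (E : ℂ) ∉ spectrum ℂ (schrodinger (potential T f 0))}

theorem isOpen_gapSet {Ω : Type*} [AddCommGroup Ω] [TopologicalSpace Ω] [CompactSpace Ω]
    (T : Ω ≃ₜ Ω) (a b : ℝ) : IsOpen (gapSet T a b) := by
  have : gapSet T a b = ⋃ E ∈ Set.Ioo a b, {f : C(Ω, ℝ) |
      IsUnit (algebraMap ℂ (ℓ²(ℤ, ℂ) →L[ℂ] ℓ²(ℤ, ℂ)) (E : ℂ) -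
        schrodinger (potential T f 0))} := by
    ext f
    simp [gapSet, spectrum.mem_iff]
  rw [this]
  exact isOpen_biUnion fun E _ => Units.isOpen.preimage
    (continuous_const.sub (continuous_schrodinger_potential T 0))

theorem isCantorSet_of_forall_gap {V : ℓ^∞(ℤ, ℝ)}
    (hacc : ∀ z ∈ spectrum ℂ (schrodinger V),
      AccPt z (Filter.principal (spectrum ℂ (schrodinger V))))
    (hgap : ∀ a b : ℚ, a < b → ∃ E ∈ Set.Ioo (a : ℝ) b,
      (E : ℂ) ∉ spectrum ℂ (schrodinger V)) :
    ∃ K : Set ℝ, IsCantorSet K ∧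
      spectrum ℂ (schrodinger V) = (fun x : ℝ => (x : ℂ)) '' K := by
  have hreal : ∀ z ∈ spectrum ℂ (schrodinger V), ((z.re : ℝ) : ℂ) = z := fun z hz =>
    ((isSelfAdjoint_schrodinger V).mem_spectrum_eq_re hz).symm
  refine ⟨{x | (x : ℂ) ∈ spectrum ℂ (schrodinger V)}, ⟨?_, ?_, ?_, ?_⟩, ?_⟩
  · obtain ⟨z, hz⟩ := spectrum.nonempty (schrodinger V)
    exact ⟨z.re, by rw [Set.mem_ofPred_eq, hreal z hz]; exact hz⟩
  · exact (spectrum.isClosed (schrodinger V)).preimage Complex.continuous_ofReal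
  · rw [Set.eq_empty_iff_forall_notMem]
    intro x hx
    obtain ⟨c, d, hx', hsub⟩ := mem_nhds_iff_exists_Ioo_subset.1 (mem_interior_iff_mem_nhds.1 hx)
    obtain ⟨a, hca, hax⟩ := exists_rat_btwn hx'.1
    obtain ⟨b, hxb, hbd⟩ := exists_rat_btwn hx'.2
    obtain ⟨E, hE, hEn⟩ := hgap a b (by exact_mod_cast hax.trans hxb)
    exact hEn (hsub ⟨hca.trans hE.1, hE.2.trans hbd⟩)
  · intro x hx
    rw [accPt_iff_nhds]
    intro U hU
    have hU' : Complex.re ⁻¹' U ∈ 𝓝 (x : ℂ) :=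
      Complex.continuous_re.continuousAt.preimage_mem_nhds (by simpa using hU)
    obtain ⟨z, ⟨hzU, hz⟩, hne⟩ := accPt_iff_nhds.1 (hacc _ hx) _ hU'
    refine ⟨z.re, ⟨hzU, by rw [Set.mem_ofPred_eq, hreal z hz]; exact hz⟩, fun h => hne ?_⟩
    rw [← hreal z hz, h]
  · ext z
    constructor
    · exact fun hz => ⟨z.re, by rw [Set.mem_ofPred_eq, hreal z hz]; exact hz, hreal z hz⟩
    · rintro ⟨x, hx, rfl⟩
      exact hx

end LimitPeriodic

theorem theoremt {Ω : Type*} [AddCommGroup Ω] [TopologicalSpace Ω]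
    [LimitPeriodic.IsCantorGroup Ω] (T : Ω ≃ₜ Ω)
    (hT : LimitPeriodic.IsTranslation T) (hmin : LimitPeriodic.IsMinimalHomeo T) :
    ∃ 𝒞 : Set C(Ω, ℝ), Dense 𝒞 ∧ IsGδ 𝒞 ∧
      ∀ f ∈ 𝒞, ∀ ω : Ω, ∃ K : Set ℝ, LimitPeriodic.IsCantorSet K ∧
        spectrum ℂ (LimitPeriodic.schrodinger (LimitPeriodic.potential T f ω)) =
          (fun x : ℝ => (x : ℂ)) '' K := by
  obtain ⟨α, hα⟩ := id hT
  refine ⟨⋂ q : {q : ℚ × ℚ // q.1 < q.2}, LimitPeriodic.gapSet T q.1.1 q.1.2, ?_, ?_, ?_⟩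
  · refine dense_iInter_of_isOpen (fun q => LimitPeriodic.isOpen_gapSet T _ _) fun q => ?_
    refine Metric.dense_iff.2 fun f r hr => ?_
    obtain ⟨g, hg, hE⟩ := LimitPeriodic.exists_approx_notMem_spectrum hα hmin f (half_pos hr)
      (a := q.1.1) (b := q.1.2) (by exact_mod_cast q.2)
    exact ⟨g, by rw [mem_ball_iff_norm]; linarith, hE⟩
  · exact IsGδ.iInter_of_isOpen fun q => LimitPeriodic.isOpen_gapSet T _ _
  · intro f hf ω
    refine LimitPeriodic.isCantorSet_of_forall_gap
      (fun z hz => LimitPeriodic.accPt_spectrum_potential hT hmin f ω hz) fun a b hab => ?_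
    -- The gap sets only test phase 0, which suffices by independence of the phase.
    rw [LimitPeriodic.spectrum_eq hT hmin f ω 0]
    exact Set.mem_iInter.1 hf ⟨(a, b), hab⟩
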